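/- Let $\Gamma\subseteq\mathbb{R}^n$ be a lattice (a discrete subgroup) and let $E$ be a finite list of elements of $\Gamma$, repetitions allowed. For a sublist $A$ of $E$ put $\mathcal{Z}(A)=\{\sum_{e\in A}\lambda_e e: 0\le\lambda_e\le 1\}$. Let $\mathbf{Ehr}_A$, in variables indexed by $A$, be the (Brändén–Moci multivariate Ehrhart) polynomial with $\mathbf{Ehr}_A(\underline{k})=|\mathcal{Z}(\{k_e e\}_{e\in A})\cap\Gamma|$ for all families $\underline{k}=(k_e)_{e\in A}$ of positive integers, and let $\mathrm{Ehr}_{\mathcal{Z}(A)}$ be the univariate (Ehrhart) polynomial with $\mathrm{Ehr}_{\mathcal{Z}(A)}(k)=|k\mathcal{Z}(A)\cap\Gamma|$ for all integers $k>0$. Let $p_e\in[0,1]$ for $e\in E$, and let $E_{\underline{p}}$ be the random sublist of $E$ obtained by independently deleting each $e\in E$ with probability $1-p_e$. All these polynomials exist and are unique, and for every $\underline{v}=(v_e)_{e\in E}\in\mathbb{R}^E$ $$\mathbb{E}\left[\mathbf{Ehr}_{E_{\underline{p}}}(\underline{v})\right]=\mathbf{Ehr}_E(\underline{pv}),\qquad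 \underline{pv}=(p_ev_e)_{e\in E},$$ where on the left $\mathbf{Ehr}_{E_{\underline p}}$ is evaluated at $(v_e)_{e\in E_{\underline p}}$. In particular, for every $t\in\mathbb{R}$, $$\mathbb{E}\left[\mathrm{Ehr}_{\mathcal{Z}(E_{\underline{p}})}(t)\right]=\mathbf{Ehr}_E\left((p_et)_{e\in E}\right).$$ If moreover $p_e=p\in(0,1]$ for all $e\in E$, then for every real $t\neq0$ $$\mathbb{E}\left[\mathrm{Ehr}_{\mathcal{Z}(E_{\underline p})}(t)\right]=(pt)^{r(E)}\,T_{\mathcal{M}}\left(1+\tfrac{1}{pt},\,1\right),$$ where $\mathcal{M}=(E,r,m)$ is the arithmetic matroid represented by $E$ in $\Gamma$, that is, $r(A)$ is the rank of the subgroup $\langle A\rangle$ generated by $A$ and $m(A)$ is the order of the torsion subgroup of $\Gamma/\langle A\rangle$, and $T_{\mathcal{M}}(x,y)=\sum_{A\subseteq E}m(A)(x-1)^{r(E)-r(A)}(y-1)^{|A|-r(A)}$ is its Tutte polynomial. -/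

import Mathlib

open MeasureTheory ProbabilityTheory

noncomputable section

namespace EhrhartZonotope

/-- The zonotope `Z(E) = { ∑ λ_i e_i : 0 ≤ λ_i ≤ 1 }` of a finite list `e` of vectors. The list is
indexed by `ι`, so that repeated entries are allowed. -/
def zonotope {n : ℕ} {ι : Type*} [Fintype ι] (e : ι → Fin n → ℝ) : Set (Fin n → ℝ) :=
  {x | ∃ c : ι → ℝ, (∀ i, 0 ≤ c i ∧ c i ≤ 1) ∧ x = ∑ i, c i • e i}

/-- The zonotope `Z(E)` of a list of elements of a subgroup `Γ` of `ℝⁿ`. -/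
def latticeZonotope {n : ℕ} (Γ : Submodule ℤ (Fin n → ℝ)) {ι : Type*} [Fintype ι] (e : ι → Γ) :
    Set (Fin n → ℝ) :=
  zonotope (fun i => (e i : Fin n → ℝ))

/-- The sublist of `e` with index set `A`. -/
def sublist {ι M : Type*} (e : ι → M) (A : Finset ι) : A → M := fun i => e i

/-- `P` is a multivariate Ehrhart polynomial of the list `e` with respect to `Γ`:
`P(k) = |Z(k · E) ∩ Γ|` for every family `k` of positive integers, where `k · E` is the list of
the `k_i e_i`. -/
def IsMultiEhrhart {n : ℕ} (Γ : Submodule ℤ (Fin n → ℝ)) {ι : Type*} [Fintype ι] (e : ι → Γ)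
    (P : MvPolynomial ι ℝ) : Prop :=
  ∀ k : ι → ℕ, (∀ i, 0 < k i) →
    MvPolynomial.eval (fun i => (k i : ℝ)) P =
      ((latticeZonotope Γ (fun i => k i • e i) ∩ (Γ : Set (Fin n → ℝ))).ncard : ℝ)

open Classical in
/-- The multivariate Ehrhart polynomial of the list `e` with respect to `Γ`. -/
def multiEhrhart {n : ℕ} (Γ : Submodule ℤ (Fin n → ℝ)) {ι : Type*} [Fintype ι] (e : ι → Γ) :
    MvPolynomial ι ℝ :=
  if h : ∃ P, IsMultiEhrhart Γ e P then h.choose else 0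

/-- `Q` is an Ehrhart polynomial of `K` with respect to `Γ`: `Q(k) = |kK ∩ Γ|` for every positive
integer `k`. -/
def IsEhrhart {n : ℕ} (Γ : Submodule ℤ (Fin n → ℝ)) (K : Set (Fin n → ℝ))
    (Q : Polynomial ℝ) : Prop :=
  ∀ k : ℕ, 0 < k →
    Q.eval (k : ℝ) = ((((fun x => (k : ℝ) • x) '' K) ∩ (Γ : Set (Fin n → ℝ))).ncard : ℝ)

open Classical in
/-- The Ehrhart polynomial of `K` with respect to `Γ`. -/
def ehrhart {n : ℕ} (Γ : Submodule ℤ (Fin n → ℝ)) (K : Set (Fin n → ℝ)) : Polynomial ℝ :=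
  if h : ∃ Q, IsEhrhart Γ K Q then h.choose else 0

/-- A ranked set with (real) multiplicity, on the ground set `ι`. -/
structure RankedSetWithMultiplicity (ι : Type*) where
  /-- the rank function -/
  rank : Finset ι → ℤ
  /-- the multiplicity function -/
  mult : Finset ι → ℝ

/-- The Tutte polynomial
`T(x, y) = ∑_A m(A) (x - 1)^(r(E) - r(A)) (y - 1)^(|A| - r(A))`, evaluated at real numbers. -/
def RankedSetWithMultiplicity.tutte {ι : Type*} [Fintype ι] (M : RankedSetWithMultiplicity ι)
    (x y : ℝ) : ℝ :=
  ∑ A : Finset ι, M.mult A * (x - 1) ^ (M.rank Finset.univ - M.rank A) *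
    (y - 1) ^ ((A.card : ℤ) - M.rank A)

/-- The arithmetic matroid represented by a list `e` in an abelian group `G`:
`r(A)` is the rank of `⟨A⟩` and `m(A)` is the order of the torsion subgroup of `G / ⟨A⟩`. -/
def arithmeticMatroid {G : Type*} [AddCommGroup G] {ι : Type*} (e : ι → G) :
    RankedSetWithMultiplicity ι where
  rank A := (Module.finrank ℤ (Submodule.span ℤ (e '' (A : Set ι))) : ℤ)
  mult A := (Nat.card (Submodule.torsion ℤ (G ⧸ Submodule.span ℤ (e '' (A : Set ι)))) : ℝ)

/-- `S` is a random subset of `ι` that contains each `i` with probability `p i`,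
independently. -/
structure IsRandomSubset {Ω : Type*} [MeasurableSpace Ω] (μ : Measure Ω) {ι : Type*}
    (p : ι → ℝ) (S : Ω → Finset ι) : Prop where
  measurableSet : ∀ i, MeasurableSet {ω | i ∈ S ω}
  indep : iIndepSet (fun i => {ω | i ∈ S ω}) μ
  prob : ∀ i, μ {ω | i ∈ S ω} = ENNReal.ofReal (p i)

end EhrhartZonotope

end

/-! The multivariate Ehrhart polynomial is explicit: `ehrhartSum`, the sum of m(A) ∏_{i ∈ A} X_i
over the independent sublists A. Since a sublist keeps exactly the terms with A ⊆ E_p, and A ⊆ E_p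
has probability ∏_{i ∈ A} p_i, linearity of expectation replaces each v_i by p_i v_i. Equal
variables give the univariate polynomial, and setting y = 1 in the Tutte polynomial keeps only the
independent A.

The formula comes from deletion-contraction (`ncard_preimage_dilatedZonotope`). Adding a segment [0,
k]a to a zonotope adds k layers of points, each in bijection with the points of the zonotope
contracted by a (`ncard_thickening`, `image_mkQ_shadow`). Contraction can create torsion, so the
induction counts preimages under homomorphisms φ : G → V from finitely generated groups. The
hypothesis `ReflectsSpan` survives contraction and makes the kernel the torsion subgroup; for Γ it
follows from discreteness. -/

namespace EhrhartZonotope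

/-! ### Counting points layer by layer along a segment. -/

section Thickening

variable {G V : Type*} [AddCommGroup G] [AddCommGroup V] [Module ℝ V]

/-- The elements of `G` whose image lies in `Z + [0, r] • φ a`. -/
def thickening (φ : G →+ V) (a : G) (Z : Set V) (r : ℝ) : Set G :=
  {g | ∃ t : ℝ, 0 ≤ t ∧ t ≤ r ∧ φ g - t • φ a ∈ Z}

/-- The elements of `G` whose image lies in `Z + ℝ • φ a`. -/
def shadow (φ : G →+ V) (a : G) (Z : Set V) : Set G :=
  {g | ∃ t : ℝ, φ g - t • φ a ∈ Z}

theorem thickening_mono (φ : G →+ V) (a : G) (Z : Set V) {r s : ℝ} (h : r ≤ s) :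
    thickening φ a Z r ⊆ thickening φ a Z s :=
  fun _ ⟨t, h0, h1, ht⟩ => ⟨t, h0, h1.trans h, ht⟩

theorem thickening_zero (φ : G →+ V) (a : G) (Z : Set V) :
    thickening φ a Z 0 = φ ⁻¹' Z := by
  ext g
  constructor
  · rintro ⟨t, h0, h1, ht⟩
    obtain rfl := le_antisymm h1 h0
    simpa using ht
  · intro hg
    exact ⟨0, le_rfl, le_rfl, by simpa using hg⟩

theorem sub_smul_mem_of_convex {Z : Set V} (hZ : Convex ℝ Z) {x y : V} {s t u : ℝ}
    (hs : x - s • y ∈ Z) (ht : x - t • y ∈ Z) (h1 : s ≤ u) (h2 : u ≤ t) : x - u • y ∈ Z := by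
  have hc : Convex ℝ {r : ℝ | x - r • y ∈ Z} := by
    intro r hr r' hr' α β hα hβ hαβ
    have := hZ hr hr' hα hβ hαβ
    have he : x - (α • r + β • r') • y = α • (x - r • y) + β • (x - r' • y) := by
      have : x = (α + β) • x := by rw [hαβ, one_smul]
      rw [smul_sub, smul_sub, smul_eq_mul, smul_eq_mul, add_smul, mul_smul, mul_smul]
      nth_rewrite 1 [this]
      rw [add_smul]
      abel
    change x - (α • r + β • r') • y ∈ Z
    rwa [he]
  exact hc.ordConnected.out hs ht ⟨h1, h2⟩

theorem map_add_zsmul_sub_smul (φ : G →+ V) (a g : G) (m : ℤ) (t : ℝ) :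
    φ (g + m • a) - t • φ a = φ g - (t - m) • φ a := by
  rw [map_add, map_zsmul, sub_smul, Int.cast_smul_eq_zsmul]
  abel

/-- If g + m a had parameter t ≤ j + 1, then g would have parameter t - m ≤ j. Either this is
nonnegative, or by convexity 0 is also a parameter of g; both put g in the smaller thickening. -/
theorem not_mem_thickening_diff_add (φ : G →+ V) (a : G) {Z : Set V} (hZ : Convex ℝ Z) (j : ℕ)
    {g : G} (hg : g ∈ thickening φ a Z (j + 1 : ℕ) \ thickening φ a Z j) {m : ℤ} (hm : 0 < m) :
    g + m • a ∉ thickening φ a Z (j + 1 : ℕ) \ thickening φ a Z j := by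
  rintro ⟨⟨t, h0, h1, ht⟩, -⟩
  obtain ⟨⟨t', h0', h1', ht'⟩, hn⟩ := hg
  rw [map_add_zsmul_sub_smul] at ht
  have hm' : (1 : ℝ) ≤ m := by exact_mod_cast hm
  push_cast at h1 h1'
  rcases le_or_gt 0 (t - m) with h | h
  · exact hn ⟨t - m, h, by linarith, ht⟩
  · exact hn ⟨0, le_rfl, by positivity, sub_smul_mem_of_convex hZ ht ht' h.le h0'⟩

theorem injOn_mkQ_thickening_diff (φ : G →+ V) (a : G) {Z : Set V} (hZ : Convex ℝ Z) (j : ℕ) :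
    Set.InjOn (Submodule.span ℤ {a}).mkQ
      (thickening φ a Z (j + 1 : ℕ) \ thickening φ a Z j) := by
  intro g hg h hh hgh
  rw [Submodule.mkQ_apply, Submodule.mkQ_apply, Submodule.Quotient.eq,
    Submodule.mem_span_singleton] at hgh
  obtain ⟨m, hm⟩ := hgh
  rcases lt_trichotomy m 0 with h' | rfl | h'
  · refine absurd hh ?_
    rw [show h = g + (-m) • a by rw [neg_smul, hm]; abel]
    exact not_mem_thickening_diff_add φ a hZ j hg (by omega)
  · rw [zero_smul] at hm
    exact (sub_eq_zero.mp hm.symm)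
  · refine absurd hg ?_
    rw [show g = h + m • a by rw [hm]; abel]
    exact not_mem_thickening_diff_add φ a hZ j hh h'

theorem thickening_subset_shadow (φ : G →+ V) (a : G) (Z : Set V) (r : ℝ) :
    thickening φ a Z r ⊆ shadow φ a Z := fun _ ⟨t, _, _, ht⟩ => ⟨t, ht⟩

theorem thickening_finite (φ : G →+ V) (a : G) {Z : Set V} (hZ : Convex ℝ Z)
    (hf : (φ ⁻¹' Z).Finite) (hs : ((Submodule.span ℤ {a}).mkQ '' shadow φ a Z).Finite) (j : ℕ) :
    (thickening φ a Z j).Finite := by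
  induction j with
  | zero => rwa [Nat.cast_zero, thickening_zero]
  | succ j ih =>
    have : (thickening φ a Z (j + 1 : ℕ) \ thickening φ a Z j).Finite :=
      Set.Finite.of_finite_image
        (hs.subset (Set.image_mono (Set.sdiff_subset.trans (thickening_subset_shadow φ a Z _))))
        (injOn_mkQ_thickening_diff φ a hZ j)
    exact (this.union ih).subset (by simp)

/-- In each coset of ⟨a⟩ meeting the shadow, the last translate inside the larger thickening lies in
the new layer: otherwise one more step along a would still stay inside. -/
theorem image_mkQ_thickening_diff (φ : G →+ V) (a : G) (ha : φ a ≠ 0) {Z : Set V} (j : ℕ)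
    (hf : (thickening φ a Z (j + 1 : ℕ)).Finite) :
    (Submodule.span ℤ {a}).mkQ '' (thickening φ a Z (j + 1 : ℕ) \ thickening φ a Z j) =
      (Submodule.span ℤ {a}).mkQ '' shadow φ a Z := by
  refine subset_antisymm
    (Set.image_mono (Set.sdiff_subset.trans (thickening_subset_shadow φ a Z _))) ?_
  rintro _ ⟨g, ⟨t, ht⟩, rfl⟩
  have hinj : Function.Injective fun m : ℤ => g + m • a := by
    intro m m' hmm
    have h : φ (m • a) = φ (m' • a) := congrArg φ (add_left_cancel hmm)
    rw [map_zsmul, map_zsmul] at h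
    rw [← Int.cast_smul_eq_zsmul ℝ, ← Int.cast_smul_eq_zsmul ℝ] at h
    exact_mod_cast smul_left_injective ℝ ha h
  have hM : {m : ℤ | g + m • a ∈ thickening φ a Z (j + 1 : ℕ)}.Finite :=
    hf.preimage hinj.injOn
  have hne : {m : ℤ | g + m • a ∈ thickening φ a Z (j + 1 : ℕ)}.Nonempty := by
    -- This shift moves the parameter t into [0, 1).
    refine ⟨⌈-t⌉, t + ⌈-t⌉, by linarith [Int.le_ceil (-t)], ?_, ?_⟩
    · push_cast
      linarith [Int.ceil_lt_add_one (-t), (Nat.cast_nonneg j : (0 : ℝ) ≤ j)]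
    · rw [map_add_zsmul_sub_smul, add_sub_cancel_right]
      exact ht
  obtain ⟨m, hm, hmax⟩ := hM.exists_maximal hne
  refine ⟨g + m • a, ⟨hm, ?_⟩, ?_⟩
  · rintro ⟨t', h0, h1, ht'⟩
    have : m + 1 ≤ m := by
      refine hmax ?_ (by omega)
      refine ⟨t' + 1, by linarith, by push_cast; linarith, ?_⟩
      rw [map_add_zsmul_sub_smul] at ht' ⊢
      convert ht' using 3
      push_cast
      ring
    omega
  · rw [Submodule.mkQ_apply, Submodule.mkQ_apply, Submodule.Quotient.eq, add_sub_cancel_left]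
    exact Submodule.smul_mem _ _ (Submodule.mem_span_singleton_self a)

theorem ncard_thickening (φ : G →+ V) (a : G) (ha : φ a ≠ 0) {Z : Set V} (hZ : Convex ℝ Z)
    (hf : (φ ⁻¹' Z).Finite) (hs : ((Submodule.span ℤ {a}).mkQ '' shadow φ a Z).Finite) (j : ℕ) :
    (thickening φ a Z j).ncard =
      (φ ⁻¹' Z).ncard + j * ((Submodule.span ℤ {a}).mkQ '' shadow φ a Z).ncard := by
  induction j with
  | zero => rw [Nat.cast_zero, thickening_zero, zero_mul, add_zero]
  | succ j ih =>
    have hfin := thickening_finite φ a hZ hf hs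
    rw [← Set.ncard_sdiff_add_ncard_of_subset
      (thickening_mono φ a Z (Nat.cast_le.mpr j.le_succ)) (hfin (j + 1)), ih,
      ← (injOn_mkQ_thickening_diff φ a hZ j).ncard_image,
      image_mkQ_thickening_diff φ a ha j (hfin (j + 1))]
    ring

end Thickening

/-! ### Contraction of homomorphisms and zonotopes. -/

section Counting

/-- Over `ℝ`, an element of `G` depends on a subgroup only if it does so rationally. -/
def ReflectsSpan {G V : Type*} [AddCommGroup G] [AddCommGroup V] [Module ℝ V]
    (φ : G →+ V) : Prop :=
  ∀ (H : Submodule ℤ G) (g : G), φ g ∈ Submodule.span ℝ (φ '' H) → ∃ N : ℤ, N ≠ 0 ∧ N • g ∈ H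

variable {G V : Type*} [AddCommGroup G] [AddCommGroup V] [Module ℝ V]

/-- The homomorphism `G / ⟨a⟩ → V / ℝ φ(a)` induced by `φ`. -/
noncomputable def contraction (φ : G →+ V) (a : G) :
    (G ⧸ Submodule.span ℤ {a}) →+ (V ⧸ Submodule.span ℝ {φ a}) :=
  ((Submodule.span ℤ {a}).liftQ
    (((Submodule.span ℝ {φ a}).mkQ.toAddMonoidHom.comp φ).toIntLinearMap) (by
      rw [Submodule.span_singleton_le_iff_mem, LinearMap.mem_ker]
      exact (Submodule.Quotient.mk_eq_zero _).mpr
        (Submodule.mem_span_singleton_self (φ a)))).toAddMonoidHom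

@[simp]
theorem contraction_mkQ (φ : G →+ V) (a g : G) :
    contraction φ a ((Submodule.span ℤ {a}).mkQ g) = (Submodule.span ℝ {φ a}).mkQ (φ g) := rfl

/-- Pull H back to G: the preimage contains a, so its real span absorbs the ambiguity modulo φ(a).
-/
theorem ReflectsSpan.contraction {φ : G →+ V} (h : ReflectsSpan φ) (a : G) :
    ReflectsSpan (contraction φ a) := by
  intro H y hy
  obtain ⟨g, rfl⟩ := Submodule.mkQ_surjective _ y
  have haH : a ∈ H.comap (Submodule.span ℤ {a}).mkQ := by
    have : (Submodule.span ℤ {a}).mkQ a = 0 :=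
      (Submodule.Quotient.mk_eq_zero _).mpr (Submodule.mem_span_singleton_self a)
    rw [Submodule.mem_comap, this]
    exact H.zero_mem
  have himg : EhrhartZonotope.contraction φ a '' H ⊆
      (Submodule.span ℝ {φ a}).mkQ '' (φ '' (H.comap (Submodule.span ℤ {a}).mkQ)) := by
    rintro _ ⟨y, hy, rfl⟩
    obtain ⟨g, rfl⟩ := Submodule.mkQ_surjective _ y
    exact ⟨φ g, ⟨g, hy, rfl⟩, rfl⟩
  have hy' := Submodule.span_mono himg hy
  rw [← Submodule.map_span, contraction_mkQ, Submodule.mem_map] at hy'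
  obtain ⟨w, hw, hwg⟩ := hy'
  rw [Submodule.mkQ_apply, Submodule.mkQ_apply, Submodule.Quotient.eq] at hwg
  have hle : Submodule.span ℝ {φ a} ≤
      Submodule.span ℝ (φ '' (H.comap (Submodule.span ℤ {a}).mkQ)) := by
    rw [Submodule.span_singleton_le_iff_mem]
    exact Submodule.subset_span ⟨a, haH, rfl⟩
  obtain ⟨N, hN, hNg⟩ := h (H.comap (Submodule.span ℤ {a}).mkQ) g (by
    simpa using Submodule.sub_mem _ hw (hle hwg))
  exact ⟨N, hN, by simpa using hNg⟩

theorem ReflectsSpan.eq_zero_iff {φ : G →+ V} (h : ReflectsSpan φ) (g : G) :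
    φ g = 0 ↔ g ∈ Submodule.torsion ℤ G := by
  rw [Submodule.mem_torsion_iff]
  constructor
  · intro hg
    obtain ⟨N, hN, hNg⟩ := h ⊥ g (by rw [hg]; exact Submodule.zero_mem _)
    exact ⟨⟨N, mem_nonZeroDivisors_of_ne_zero hN⟩, by simpa using hNg⟩
  · rintro ⟨⟨N, hN⟩, hNg⟩
    have h' : φ (N • g) = 0 := by
      rw [show N • g = 0 from hNg, map_zero]
    rw [map_zsmul, ← Int.cast_smul_eq_zsmul ℝ] at h'
    refine (smul_eq_zero.mp h').resolve_left ?_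
    exact_mod_cast nonZeroDivisors.ne_zero hN

variable {ι : Type*}

/-- The zonotope `∑_{i ∈ s} [0, k i] • w i`. -/
def dilatedZonotope (w : ι → V) (k : ι → ℕ) (s : Finset ι) : Set V :=
  {x | ∃ c : ι → ℝ, (∀ i ∈ s, 0 ≤ c i ∧ c i ≤ k i) ∧ x = ∑ i ∈ s, c i • w i}

theorem convex_dilatedZonotope (w : ι → V) (k : ι → ℕ) (s : Finset ι) :
    Convex ℝ (dilatedZonotope w k s) := by
  rintro _ ⟨c, hc, rfl⟩ _ ⟨d, hd, rfl⟩ α β hα hβ hαβ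
  refine ⟨fun i => α * c i + β * d i, fun i hi => ?_, ?_⟩
  · obtain ⟨h1, h2⟩ := hc i hi
    obtain ⟨h3, h4⟩ := hd i hi
    refine ⟨by positivity, ?_⟩
    calc α * c i + β * d i ≤ α * k i + β * k i := by gcongr
      _ = k i := by rw [← add_mul, hαβ, one_mul]
  · simp only [add_smul, mul_smul, Finset.sum_add_distrib, Finset.smul_sum]

theorem map_dilatedZonotope {W : Type*} [AddCommGroup W] [Module ℝ W] (f : V →ₗ[ℝ] W) (w : ι → V)
    (k : ι → ℕ) (s : Finset ι) :
    f '' dilatedZonotope w k s = dilatedZonotope (f ∘ w) k s := by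
  ext y
  constructor
  · rintro ⟨_, ⟨c, hc, rfl⟩, rfl⟩
    exact ⟨c, hc, by simp⟩
  · rintro ⟨c, hc, rfl⟩
    exact ⟨_, ⟨c, hc, rfl⟩, by simp⟩

theorem preimage_dilatedZonotope_insert [DecidableEq ι] (φ : G →+ V) (e : ι → G) (k : ι → ℕ)
    {s : Finset ι} {a : ι} (ha : a ∉ s) :
    φ ⁻¹' dilatedZonotope (φ ∘ e) k (insert a s) =
      thickening φ (e a) (dilatedZonotope (φ ∘ e) k s) (k a) := by
  ext g
  constructor
  · rintro ⟨c, hc, hg⟩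
    obtain ⟨h0, h1⟩ := hc a (Finset.mem_insert_self a s)
    refine ⟨c a, h0, h1, c, fun i hi => hc i (Finset.mem_insert_of_mem hi), ?_⟩
    rw [hg, Finset.sum_insert ha, Function.comp_apply, add_sub_cancel_left]
  · rintro ⟨t, h0, h1, c, hc, hg⟩
    have hne : ∀ i ∈ s, i ≠ a := fun i hi h => ha (h ▸ hi)
    refine ⟨Function.update c a t, ?_, ?_⟩
    · intro i hi
      rcases Finset.mem_insert.mp hi with rfl | hi
      · simpa using ⟨h0, h1⟩
      · simpa [hne i hi] using hc i hi
    · rw [Finset.sum_insert ha, Function.update_self, Function.comp_apply]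
      rw [Finset.sum_congr rfl fun i hi => by rw [Function.update_of_ne (hne i hi)], ← hg]
      abel

theorem image_mkQ_shadow (φ : G →+ V) (e : ι → G) (k : ι → ℕ) (s : Finset ι) (a : G) :
    (Submodule.span ℤ {a}).mkQ '' shadow φ a (dilatedZonotope (φ ∘ e) k s) =
      contraction φ a ⁻¹'
        dilatedZonotope (contraction φ a ∘ ((Submodule.span ℤ {a}).mkQ ∘ e)) k s := by
  have he : contraction φ a ∘ ((Submodule.span ℤ {a}).mkQ ∘ e) =
    (Submodule.span ℝ {φ a}).mkQ ∘ (φ ∘ e) := rfl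
  rw [he, ← map_dilatedZonotope]
  ext y
  obtain ⟨g, rfl⟩ := Submodule.mkQ_surjective _ y
  constructor
  · rintro ⟨g', ⟨t, ht⟩, hg'⟩
    rw [← hg']
    refine ⟨_, ht, ?_⟩
    rw [contraction_mkQ, map_sub, sub_eq_self, map_smul]
    have : (Submodule.span ℝ {φ a}).mkQ (φ a) = 0 :=
      (Submodule.Quotient.mk_eq_zero _).mpr (Submodule.mem_span_singleton_self _)
    rw [this, smul_zero]
  · rintro ⟨z, hz, hzg⟩
    rw [contraction_mkQ, Submodule.mkQ_apply, Submodule.mkQ_apply, eq_comm,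
      Submodule.Quotient.eq, Submodule.mem_span_singleton] at hzg
    obtain ⟨t, ht⟩ := hzg
    exact ⟨g, ⟨t, by rwa [ht, sub_sub_cancel]⟩, rfl⟩

end Counting

/-! ### The point count by deletion-contraction. -/

section DeletionContraction

universe u v

theorem card_torsion_congr {M N : Type*} [AddCommGroup M] [AddCommGroup N] (f : M ≃ₗ[ℤ] N) :
    Nat.card (Submodule.torsion ℤ M) = Nat.card (Submodule.torsion ℤ N) := by
  refine Nat.card_congr (f.toEquiv.subtypeEquiv fun x => ?_)
  simp only [Submodule.mem_torsion_iff, Submonoid.smul_def, LinearEquiv.coe_toEquiv, ← map_smul,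
    EmbeddingLike.map_eq_zero_iff]

variable {ι : Type*}

/-- The order of the torsion subgroup of `G / ⟨A⟩`. -/
noncomputable def torsionMult {G : Type*} [AddCommGroup G] (e : ι → G) (A : Finset ι) : ℕ :=
  Nat.card (Submodule.torsion ℤ (G ⧸ Submodule.span ℤ (e '' (A : Set ι))))

theorem torsionMult_empty {G : Type*} [AddCommGroup G] (e : ι → G) :
    torsionMult e ∅ = Nat.card (Submodule.torsion ℤ G) :=
  card_torsion_congr (Submodule.quotEquivOfEqBot _ (by simp))

/-- Dividing by ⟨a⟩ and then by the image of ⟨A⟩ is dividing by ⟨A ∪ {a}⟩. -/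
theorem torsionMult_contraction [DecidableEq ι] {G : Type*} [AddCommGroup G] (e : ι → G)
    (A : Finset ι) (a : ι) :
    torsionMult ((Submodule.span ℤ {e a}).mkQ ∘ e) A = torsionMult e (insert a A) := by
  refine card_torsion_congr ((Submodule.quotEquivOfEq _ _ ?_).trans
    ((Submodule.quotientQuotientEquivQuotientSup (Submodule.span ℤ {e a})
      (Submodule.span ℤ (e '' (A : Set ι)))).trans (Submodule.quotEquivOfEq _ _ ?_)))
  · rw [Submodule.map_span, ← Set.image_comp]
  · rw [← Submodule.span_union, Finset.coe_insert, Set.image_insert_eq, Set.singleton_union]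

theorem linearIndepOn_contraction_iff [DecidableEq ι] {G V : Type*} [AddCommGroup G]
    [AddCommGroup V] [Module ℝ V] (φ : G →+ V) (e : ι → G) {A : Finset ι} {a : ι} (ha : a ∉ A)
    (hea : φ (e a) ≠ 0) :
    LinearIndepOn ℝ (contraction φ (e a) ∘ ((Submodule.span ℤ {e a}).mkQ ∘ e)) (A : Set ι) ↔
      LinearIndepOn ℝ (φ ∘ e) ((insert a A : Finset ι) : Set ι) := by
  have h := LinearIndepOn.quotient_iff_union (R := ℝ) (f := φ ∘ e) (s := {a}) (t := (A : Set ι))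
    (LinearIndepOn.singleton hea) (by simpa using ha)
  rw [Set.image_singleton, Set.singleton_union] at h
  rw [Finset.coe_insert]
  exact h

open Classical in
/-- The number of elements of `G` that `φ` maps into the zonotope `∑_{i ∈ s} [0, k i] • φ(e i)`. -/
theorem ncard_preimage_dilatedZonotope (k : ι → ℕ) (s : Finset ι) :
    ∀ {G : Type u} {V : Type v} [AddCommGroup G] [Module.Finite ℤ G] [AddCommGroup V] [Module ℝ V]
      (φ : G →+ V), ReflectsSpan φ → ∀ e : ι → G,
      (φ ⁻¹' dilatedZonotope (φ ∘ e) k s).Finite ∧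
      (φ ⁻¹' dilatedZonotope (φ ∘ e) k s).ncard =
        ∑ A ∈ s.powerset with LinearIndepOn ℝ (φ ∘ e) ((A : Finset ι) : Set ι),
          torsionMult e A * ∏ i ∈ A, k i := by
  induction s using Finset.induction_on with
  | empty =>
    intro G V _ _ _ _ φ hφ e
    -- The empty zonotope is {0}, and its preimage, the kernel, is the torsion subgroup, which is
    -- finite because G is finitely generated.
    have h : φ ⁻¹' dilatedZonotope (φ ∘ e) k ∅ = (Submodule.torsion ℤ G : Set G) := by
      ext g
      rw [SetLike.mem_coe, ← hφ.eq_zero_iff]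
      simp [dilatedZonotope]
    have : Finite (Submodule.torsion ℤ G) :=
      Module.finite_of_fg_torsion _ (Submodule.torsion_isTorsion)
    refine ⟨h ▸ Set.toFinite _, ?_⟩
    rw [h, Finset.powerset_empty, Finset.filter_singleton, if_pos (by simp), Finset.sum_singleton,
      Finset.prod_empty, mul_one, torsionMult_empty]
    exact (Nat.card_coe_set_eq _).symm
  | insert a s ha ih =>
    intro G V _ _ _ _ φ hφ e
    obtain ⟨hf, hc⟩ := ih φ hφ e
    obtain ⟨hf', hc'⟩ := ih (contraction φ (e a)) (hφ.contraction (e a))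
      ((Submodule.span ℤ {e a}).mkQ ∘ e)
    rw [← image_mkQ_shadow] at hf' hc'
    rw [preimage_dilatedZonotope_insert φ e k ha, Finset.sum_filter, Finset.sum_powerset_insert ha,
      ← Finset.sum_filter, ← hc]
    -- A vector sent to 0 neither enlarges the zonotope nor belongs to an independent set.
    by_cases hea : φ (e a) = 0
    · have hZ : thickening φ (e a) (dilatedZonotope (φ ∘ e) k s) (k a) =
          φ ⁻¹' dilatedZonotope (φ ∘ e) k s := by
        ext g
        simp only [thickening, hea, smul_zero, sub_zero, Set.mem_ofPred_eq, Set.mem_preimage]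
        exact ⟨fun ⟨_, _, _, h⟩ => h, fun h => ⟨0, le_rfl, Nat.cast_nonneg _, h⟩⟩
      rw [hZ]
      refine ⟨hf, (add_eq_left.mpr (Finset.sum_eq_zero fun A _ => if_neg fun h => ?_)).symm⟩
      exact h.ne_zero (Finset.mem_coe.mpr (Finset.mem_insert_self a A)) hea
    · have hconv := convex_dilatedZonotope (φ ∘ e) k s
      refine ⟨thickening_finite φ _ hconv hf hf' _, ?_⟩
      rw [ncard_thickening φ _ hea hconv hf hf', hc', Finset.mul_sum, Finset.sum_filter]
      congr 1
      refine Finset.sum_congr rfl fun A hA => ?_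
      have haA : a ∉ A := fun h => ha (Finset.mem_powerset.mp hA h)
      rw [linearIndepOn_contraction_iff φ e haA hea, torsionMult_contraction,
        Finset.prod_insert haA]
      refine if_congr Iff.rfl ?_ rfl
      ring

end DeletionContraction

/-! ### Discreteness: real and integral rank agree. -/

section Lattice

variable {n : ℕ}

theorem finrank_span_real_eq_int (Γ : Submodule ℤ (Fin n → ℝ)) [DiscreteTopology Γ]
    {s : Set (Fin n → ℝ)} (hs : s ⊆ Γ) :
    Module.finrank ℝ (Submodule.span ℝ s) = Module.finrank ℤ (Submodule.span ℤ s) :=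
  Real.finrank_eq_int_finrank_of_discrete
    (DiscreteTopology.of_subset ‹DiscreteTopology Γ› (Submodule.span_le.mpr hs))

theorem finrank_span_coe (Γ : Submodule ℤ (Fin n → ℝ)) [DiscreteTopology Γ] (s : Set Γ) :
    Module.finrank ℝ (Submodule.span ℝ ((↑) '' s : Set (Fin n → ℝ))) =
      Module.finrank ℤ (Submodule.span ℤ s) := by
  rw [finrank_span_real_eq_int Γ (by rintro _ ⟨x, _, rfl⟩; exact x.2)]
  have : Submodule.span ℤ ((↑) '' s : Set (Fin n → ℝ)) = (Submodule.span ℤ s).map Γ.subtype := by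
    rw [Submodule.map_span]
    rfl
  rw [this]
  exact (Submodule.equivMapOfInjective Γ.subtype Γ.injective_subtype _).symm.finrank_eq

/-- Adjoining g to H does not raise the real rank, hence not the integral rank, so the quotient of
the enlarged group by H is torsion. -/
theorem reflectsSpan_subtype (Γ : Submodule ℤ (Fin n → ℝ)) [DiscreteTopology Γ] :
    ReflectsSpan Γ.subtype.toAddMonoidHom := by
  intro H g hg
  let K : Submodule ℤ Γ := Submodule.span ℤ (insert g (H : Set Γ))
  have hHK : H ≤ K := fun x hx => Submodule.subset_span (Set.mem_insert_of_mem g hx)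
  have hrank : Module.finrank ℤ K = Module.finrank ℤ H := by
    have hspan : Submodule.span ℝ (insert (g : Fin n → ℝ) ((↑) '' (H : Set Γ))) =
        Submodule.span ℝ ((↑) '' (H : Set Γ)) := Submodule.span_insert_eq_span hg
    rw [← finrank_span_coe Γ, Set.image_insert_eq, hspan, finrank_span_coe, Submodule.span_eq]
  have hquot : Module.finrank ℤ (K ⧸ H.submoduleOf K) = 0 := by
    have h1 := Submodule.finrank_quotient_add_finrank (H.submoduleOf K)
    have h2 := (Submodule.submoduleOfEquivOfLe hHK).finrank_eq
    omega
  have htors := Module.finrank_eq_zero_iff_isTorsion.mp hquot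
  obtain ⟨⟨N, hN⟩, hNg⟩ := @htors ((H.submoduleOf K).mkQ
    ⟨g, Submodule.subset_span (Set.mem_insert g _)⟩)
  refine ⟨N, nonZeroDivisors.ne_zero hN, ?_⟩
  rw [Submonoid.mk_smul, ← map_smul, Submodule.mkQ_apply, Submodule.Quotient.mk_eq_zero] at hNg
  exact hNg

variable {ι : Type*}

theorem linearIndepOn_coe_iff (Γ : Submodule ℤ (Fin n → ℝ)) [DiscreteTopology Γ] (e : ι → Γ)
    (A : Finset ι) :
    LinearIndepOn ℝ (Γ.subtype.toAddMonoidHom ∘ e) (A : Set ι) ↔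
      (arithmeticMatroid e).rank A = A.card := by
  rw [LinearIndepOn, linearIndependent_iff_card_eq_finrank_span, Set.finrank]
  have h : Set.range (fun i : (A : Set ι) => (Γ.subtype.toAddMonoidHom ∘ e) i) =
      ((↑) '' (e '' (A : Set ι)) : Set (Fin n → ℝ)) := by
    rw [← Set.image_comp, Set.image_eq_range]
    rfl
  rw [h, finrank_span_coe]
  simp [arithmeticMatroid, eq_comm]

end Lattice

/-! ### The explicit Ehrhart polynomials and the Tutte polynomial at y = 1. -/

section Polynomials

variable {n : ℕ} {ι : Type*}

open Classical in
/-- The coefficient of the multivariate Ehrhart polynomial at the squarefree monomial of `A`. -/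
noncomputable def ehrhartCoeff {G : Type*} [AddCommGroup G] (e : ι → G) (A : Finset ι) : ℝ :=
  if (arithmeticMatroid e).rank A = A.card then (arithmeticMatroid e).mult A else 0

/-- Coefficients do not depend on the ambient list, so passing to a sublist only discards terms. -/
theorem ehrhartCoeff_sublist {G : Type*} [AddCommGroup G] (e : ι → G) (A : Finset ι)
    (B : Finset A) :
    ehrhartCoeff (sublist e A) B = ehrhartCoeff e (B.map (Function.Embedding.subtype _)) := by
  have h : sublist e A '' (B : Set A) =
      e '' (B.map (Function.Embedding.subtype _) : Finset ι) := by
    rw [Finset.coe_map, ← Set.image_comp]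
    rfl
  have hrank : (arithmeticMatroid (sublist e A)).rank B =
      (arithmeticMatroid e).rank (B.map (Function.Embedding.subtype _)) :=
    congrArg (fun s : Set G => (Module.finrank ℤ (Submodule.span ℤ s) : ℤ)) h
  have hmult : (arithmeticMatroid (sublist e A)).mult B =
      (arithmeticMatroid e).mult (B.map (Function.Embedding.subtype _)) :=
    congrArg (fun s : Set G =>
      (Nat.card (Submodule.torsion ℤ (G ⧸ Submodule.span ℤ s)) : ℝ)) h
  rw [ehrhartCoeff, ehrhartCoeff, hrank, hmult, Finset.card_map]

/-- The polynomial `∑_A m(A) ∏_{i ∈ A} X i`, over the independent sublists `A` of `e`. -/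
noncomputable def ehrhartSum [Fintype ι] {G : Type*} [AddCommGroup G] (e : ι → G) :
    MvPolynomial ι ℝ :=
  ∑ A : Finset ι, MvPolynomial.C (ehrhartCoeff e A) * ∏ i ∈ A, MvPolynomial.X i

theorem eval_ehrhartSum [Fintype ι] {G : Type*} [AddCommGroup G] (e : ι → G) (v : ι → ℝ) :
    MvPolynomial.eval v (ehrhartSum e) = ∑ A : Finset ι, ehrhartCoeff e A * ∏ i ∈ A, v i := by
  simp [ehrhartSum]

theorem eval_ehrhartSum_sublist {G : Type*} [AddCommGroup G] (e : ι → G) (A : Finset ι)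
    (v : ι → ℝ) :
    MvPolynomial.eval (fun i : A => v i) (ehrhartSum (sublist e A)) =
      ∑ B ∈ A.powerset, ehrhartCoeff e B * ∏ i ∈ B, v i := by
  classical
  rw [eval_ehrhartSum]
  refine Finset.sum_nbij (fun B => B.map (Function.Embedding.subtype _)) ?_ ?_ ?_ ?_
  · intro B _
    rw [Finset.mem_powerset]
    intro x hx
    obtain ⟨y, _, rfl⟩ := Finset.mem_map.mp hx
    exact y.2
  · exact (Finset.map_injective _).injOn
  · intro B hB
    refine ⟨B.subtype (· ∈ A), Finset.mem_coe.mpr (Finset.mem_univ _), ?_⟩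
    exact Finset.subtype_map_of_mem fun x hx => Finset.mem_powerset.mp hB hx
  · intro B _
    rw [ehrhartCoeff_sublist, Finset.prod_map]
    rfl

theorem tutte_one_right [Fintype ι] {G : Type*} [AddCommGroup G] (e : ι → G) {x : ℝ}
    (hx : x ≠ 0) :
    x ^ (arithmeticMatroid e).rank Finset.univ * (arithmeticMatroid e).tutte (1 + x⁻¹) 1 =
      MvPolynomial.eval (fun _ => x) (ehrhartSum e) := by
  rw [RankedSetWithMultiplicity.tutte, eval_ehrhartSum, Finset.mul_sum]
  refine Finset.sum_congr rfl fun A _ => ?_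
  rw [ehrhartCoeff, sub_self, add_sub_cancel_left, Finset.prod_const]
  split_ifs with h
  · rw [h, sub_self, zpow_zero, mul_one, inv_zpow', neg_sub, zpow_sub₀ hx, zpow_natCast]
    field_simp
  -- An integer power of 0 vanishes for every nonzero exponent, so dependent A drop out.
  · rw [zero_zpow _ (sub_ne_zero.mpr (Ne.symm h))]
    simp

theorem eval_aeval_X {σ : Type*} (P : MvPolynomial σ ℝ) (t : ℝ) :
    (MvPolynomial.aeval (fun _ => (Polynomial.X : Polynomial ℝ)) P).eval t =
      MvPolynomial.eval (fun _ => t) P := by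
  induction P using MvPolynomial.induction_on with
  | C a => simp
  | add P Q hP hQ => simp [hP, hQ]
  | mul_X P i hP => simp [hP]

variable [Fintype ι]

variable (Γ : Submodule ℤ (Fin n → ℝ))

theorem latticeZonotope_smul_inter (e : ι → Γ) (k : ι → ℕ) :
    latticeZonotope Γ (fun i => k i • e i) ∩ (Γ : Set (Fin n → ℝ)) =
      (↑) '' (Γ.subtype.toAddMonoidHom ⁻¹'
        dilatedZonotope (Γ.subtype.toAddMonoidHom ∘ e) k Finset.univ) := by
  ext x
  constructor
  · rintro ⟨⟨c, hc, hx⟩, hxΓ⟩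
    refine ⟨⟨x, hxΓ⟩, ⟨fun i => c i * k i, fun i _ => ⟨?_, ?_⟩, ?_⟩, rfl⟩
    · exact mul_nonneg (hc i).1 (Nat.cast_nonneg _)
    · exact mul_le_of_le_one_left (Nat.cast_nonneg _) (hc i).2
    · change x = _
      rw [hx]
      refine Finset.sum_congr rfl fun i _ => ?_
      rw [mul_smul, Nat.cast_smul_eq_nsmul]
      rfl
  · rintro ⟨g, ⟨c, hc, hg⟩, rfl⟩
    refine ⟨⟨fun i => c i / k i, fun i => ⟨?_, ?_⟩, ?_⟩, g.2⟩
    · exact div_nonneg (hc i (Finset.mem_univ i)).1 (Nat.cast_nonneg _)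
    · exact div_le_one_of_le₀ (hc i (Finset.mem_univ i)).2 (Nat.cast_nonneg _)
    · refine hg.trans (Finset.sum_congr rfl fun i _ => ?_)
      obtain ⟨h0, h1⟩ := hc i (Finset.mem_univ i)
      change c i • (e i : Fin n → ℝ) = (c i / k i) • (k i • (e i : Fin n → ℝ))
      rw [← Nat.cast_smul_eq_nsmul ℝ, smul_smul]
      -- If `k i = 0` then `c i = 0`, and the quotient `c i / k i` is 0 by convention.
      rcases Nat.eq_zero_or_pos (k i) with hk | hk
      · rw [hk, Nat.cast_zero] at h1
        rw [le_antisymm h1 h0, zero_div, zero_mul]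
      · rw [div_mul_cancel₀ _ (by positivity)]

theorem smul_image_latticeZonotope (e : ι → Γ) (k : ℕ) :
    (fun x => (k : ℝ) • x) '' latticeZonotope Γ e = latticeZonotope Γ (fun i => k • e i) := by
  have h (c : ι → ℝ) : ∑ i, c i • ((k • e i : Γ) : Fin n → ℝ) =
      (k : ℝ) • ∑ i, c i • (e i : Fin n → ℝ) := by
    rw [Finset.smul_sum]
    refine Finset.sum_congr rfl fun i _ => ?_
    rw [smul_comm, Nat.cast_smul_eq_nsmul]
    rfl
  ext x
  constructor
  · rintro ⟨_, ⟨c, hc, rfl⟩, rfl⟩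
    exact ⟨c, hc, (h c).symm⟩
  · rintro ⟨c, hc, rfl⟩
    exact ⟨_, ⟨c, hc, rfl⟩, (h c).symm⟩

theorem IsMultiEhrhart.unique {e : ι → Γ} {P Q : MvPolynomial ι ℝ} (hP : IsMultiEhrhart Γ e P)
    (hQ : IsMultiEhrhart Γ e Q) : P = Q := by
  refine MvPolynomial.funext_set (fun _ => (fun k : ℕ => (k : ℝ)) '' Set.Ioi 0)
    (fun _ => (Set.Ioi_infinite 0).image Nat.cast_injective.injOn) fun x hx => ?_
  choose k hk hkx using fun i => hx i (Set.mem_univ i)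
  obtain rfl : (fun i => (k i : ℝ)) = x := funext hkx
  rw [hP k hk, hQ k hk]

theorem IsEhrhart.unique {K : Set (Fin n → ℝ)} {P Q : Polynomial ℝ} (hP : IsEhrhart Γ K P)
    (hQ : IsEhrhart Γ K Q) : P = Q := by
  refine Polynomial.eq_of_infinite_eval_eq P Q
    (((Set.Ioi_infinite 0).image (Nat.cast_injective (R := ℝ)).injOn).mono ?_)
  rintro _ ⟨k, hk, rfl⟩
  exact (hP k hk).trans (hQ k hk).symm

/-- Dilating the zonotope by k dilates every generator by k, so the diagonal restriction does the
count. -/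
theorem isEhrhart_aeval {e : ι → Γ} {P : MvPolynomial ι ℝ} (hP : IsMultiEhrhart Γ e P) :
    IsEhrhart Γ (latticeZonotope Γ e)
      (MvPolynomial.aeval (fun _ => (Polynomial.X : Polynomial ℝ)) P) := by
  intro k hk
  rw [smul_image_latticeZonotope, ← hP (fun _ => k) fun _ => hk, eval_aeval_X]

variable [DiscreteTopology Γ]

theorem isMultiEhrhart_ehrhartSum (e : ι → Γ) : IsMultiEhrhart Γ e (ehrhartSum e) := by
  classical
  intro k _
  rw [latticeZonotope_smul_inter, Set.ncard_image_of_injective _ Subtype.val_injective,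
    (ncard_preimage_dilatedZonotope k Finset.univ _ (reflectsSpan_subtype Γ) e).2,
    eval_ehrhartSum, Finset.powerset_univ, Finset.sum_filter, Nat.cast_sum]
  refine Finset.sum_congr rfl fun A _ => ?_
  rw [linearIndepOn_coe_iff, ehrhartCoeff]
  split_ifs
  · rw [Nat.cast_mul, Nat.cast_prod]
    rfl
  · simp

theorem multiEhrhart_eq (e : ι → Γ) : multiEhrhart Γ e = ehrhartSum e := by
  have h : ∃ P, IsMultiEhrhart Γ e P := ⟨_, isMultiEhrhart_ehrhartSum Γ e⟩
  rw [multiEhrhart, dif_pos h]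
  exact h.choose_spec.unique Γ (isMultiEhrhart_ehrhartSum Γ e)

theorem eval_ehrhart_latticeZonotope (e : ι → Γ) (t : ℝ) :
    (ehrhart Γ (latticeZonotope Γ e)).eval t =
      MvPolynomial.eval (fun _ => t) (ehrhartSum e) := by
  have hQ := isEhrhart_aeval Γ (isMultiEhrhart_ehrhartSum Γ e)
  have h : ∃ Q, IsEhrhart Γ (latticeZonotope Γ e) Q := ⟨_, hQ⟩
  rw [ehrhart, dif_pos h, h.choose_spec.unique Γ hQ, eval_aeval_X]

end Polynomials

/-! ### Expectation over a random sublist. -/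

section Expectation

variable {Ω : Type*} [MeasurableSpace Ω] {μ : Measure Ω} {ι : Type*}
  {p : ι → ℝ} {S : Ω → Finset ι}

theorem IsRandomSubset.measurableSet_subset (hS : IsRandomSubset μ p S) (B : Finset ι) :
    MeasurableSet {ω | B ⊆ S ω} := by
  have : {ω | B ⊆ S ω} = ⋂ i ∈ B, {ω | i ∈ S ω} := by
    ext ω
    simp [Finset.subset_iff]
  rw [this]
  exact B.measurableSet_biInter fun i _ => hS.measurableSet i

theorem IsRandomSubset.measureReal_subset (hS : IsRandomSubset μ p S) (hp : ∀ i, 0 ≤ p i)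
    (B : Finset ι) : μ.real {ω | B ⊆ S ω} = ∏ i ∈ B, p i := by
  have : {ω | B ⊆ S ω} = ⋂ i ∈ B, {ω | i ∈ S ω} := by
    ext ω
    simp [Finset.subset_iff]
  rw [this, measureReal_def, hS.indep.meas_biInter, ENNReal.toReal_prod]
  exact Finset.prod_congr rfl fun i _ => by rw [hS.prob, ENNReal.toReal_ofReal (hp i)]

/-- The random sum is a fixed finite sum of indicators of the events B ⊆ S, whose probabilities are
products by independence. -/
theorem IsRandomSubset.sum_powerset [IsProbabilityMeasure μ] [Fintype ι]
    (hS : IsRandomSubset μ p S) (hp : ∀ i, 0 ≤ p i)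
    (F : Finset ι → ℝ) :
    Integrable (fun ω => ∑ B ∈ (S ω).powerset, F B) μ ∧
      ∫ ω, ∑ B ∈ (S ω).powerset, F B ∂μ = ∑ B, F B * ∏ i ∈ B, p i := by
  classical
  have h : (fun ω => ∑ B ∈ (S ω).powerset, F B) =
      fun ω => ∑ B, {ω | B ⊆ S ω}.indicator (fun _ => F B) ω := by
    funext ω
    simp only [Set.indicator_apply, Set.mem_ofPred_eq]
    rw [← Finset.sum_filter]
    refine Finset.sum_congr ?_ fun _ _ => rfl
    ext B
    simp
  have hint (B : Finset ι) : Integrable ({ω | B ⊆ S ω}.indicator fun _ => F B) μ :=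
    (integrable_const _).indicator (hS.measurableSet_subset B)
  rw [h]
  refine ⟨integrable_finsetSum _ fun B _ => hint B, ?_⟩
  rw [integral_finsetSum _ fun B _ => hint B]
  refine Finset.sum_congr rfl fun B _ => ?_
  rw [integral_indicator_const _ (hS.measurableSet_subset B), hS.measureReal_subset hp,
    smul_eq_mul, mul_comm]

end Expectation

end EhrhartZonotope

theorem theorem3p7 {n : ℕ} (Γ : Submodule ℤ (Fin n → ℝ)) [DiscreteTopology Γ]
    {ι : Type*} [Fintype ι] (e : ι → Γ)
    {Ω : Type*} [MeasurableSpace Ω] (μ : Measure Ω) [IsProbabilityMeasure μ]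
    (p : ι → ℝ) (hp : ∀ i, 0 ≤ p i ∧ p i ≤ 1)
    (S : Ω → Finset ι) (hS : EhrhartZonotope.IsRandomSubset μ p S) :
    -- the Ehrhart polynomials of the list and of all its sublists exist and are unique
    (∃! P, EhrhartZonotope.IsMultiEhrhart Γ e P) ∧
    (∀ A : Finset ι,
      (∃! P, EhrhartZonotope.IsMultiEhrhart Γ (EhrhartZonotope.sublist e A) P) ∧
      (∃! Q, EhrhartZonotope.IsEhrhart Γ
        (EhrhartZonotope.latticeZonotope Γ (EhrhartZonotope.sublist e A)) Q)) ∧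
    -- expectation of the multivariate Ehrhart polynomial
    (∀ v : ι → ℝ,
      Integrable (fun ω => MvPolynomial.eval (fun i : S ω => v i)
        (EhrhartZonotope.multiEhrhart Γ (EhrhartZonotope.sublist e (S ω)))) μ ∧
      ∫ ω, MvPolynomial.eval (fun i : S ω => v i)
        (EhrhartZonotope.multiEhrhart Γ (EhrhartZonotope.sublist e (S ω))) ∂μ =
        MvPolynomial.eval (fun i => p i * v i) (EhrhartZonotope.multiEhrhart Γ e)) ∧
    -- expectation of the ordinary Ehrhart polynomial
    (∀ t : ℝ,
      Integrable (fun ω => (EhrhartZonotope.ehrhart Γ (EhrhartZonotope.latticeZonotope Γ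
        (EhrhartZonotope.sublist e (S ω)))).eval t) μ ∧
      ∫ ω, (EhrhartZonotope.ehrhart Γ (EhrhartZonotope.latticeZonotope Γ
        (EhrhartZonotope.sublist e (S ω)))).eval t ∂μ =
        MvPolynomial.eval (fun i => p i * t) (EhrhartZonotope.multiEhrhart Γ e)) ∧
    -- the same in terms of the arithmetic Tutte polynomial, for equal probabilities
    (∀ q : ℝ, 0 < q → q ≤ 1 → (∀ i, p i = q) → ∀ t : ℝ, t ≠ 0 →
      ∫ ω, (EhrhartZonotope.ehrhart Γ (EhrhartZonotope.latticeZonotope Γ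
        (EhrhartZonotope.sublist e (S ω)))).eval t ∂μ =
        (q * t) ^ (EhrhartZonotope.arithmeticMatroid e).rank Finset.univ *
          (EhrhartZonotope.arithmeticMatroid e).tutte (1 + (q * t)⁻¹) 1) := by
  have hmulti (v : ι → ℝ) := hS.sum_powerset (fun i => (hp i).1)
    fun B => EhrhartZonotope.ehrhartCoeff e B * ∏ i ∈ B, v i
  have hprod (v : ι → ℝ) : ∑ B : Finset ι, EhrhartZonotope.ehrhartCoeff e B * (∏ i ∈ B, v i) *
      ∏ i ∈ B, p i = MvPolynomial.eval (fun i => p i * v i) (EhrhartZonotope.ehrhartSum e) := by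
    rw [EhrhartZonotope.eval_ehrhartSum]
    refine Finset.sum_congr rfl fun B _ => ?_
    rw [Finset.prod_mul_distrib, mul_assoc, mul_comm (∏ i ∈ B, p i)]
  have huni (t : ℝ) :
      (fun ω => (EhrhartZonotope.ehrhart Γ (EhrhartZonotope.latticeZonotope Γ
        (EhrhartZonotope.sublist e (S ω)))).eval t) =
      fun ω => ∑ B ∈ (S ω).powerset, EhrhartZonotope.ehrhartCoeff e B * ∏ i ∈ B, t := by
    funext ω
    rw [EhrhartZonotope.eval_ehrhart_latticeZonotope]
    exact EhrhartZonotope.eval_ehrhartSum_sublist e (S ω) fun _ => t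
  refine ⟨⟨_, EhrhartZonotope.isMultiEhrhart_ehrhartSum Γ e, fun P hP =>
    hP.unique Γ (EhrhartZonotope.isMultiEhrhart_ehrhartSum Γ e)⟩, fun A => ?_, fun v => ?_,
    fun t => ?_, fun q hq _ hpq t ht => ?_⟩
  · have hP := EhrhartZonotope.isMultiEhrhart_ehrhartSum Γ (EhrhartZonotope.sublist e A)
    exact ⟨⟨_, hP, fun P h => h.unique Γ hP⟩, _, EhrhartZonotope.isEhrhart_aeval Γ hP,
      fun Q h => h.unique Γ (EhrhartZonotope.isEhrhart_aeval Γ hP)⟩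
  · simp only [EhrhartZonotope.multiEhrhart_eq, EhrhartZonotope.eval_ehrhartSum_sublist]
    exact ⟨(hmulti v).1, (hmulti v).2.trans (hprod v)⟩
  · rw [huni, EhrhartZonotope.multiEhrhart_eq]
    exact ⟨(hmulti fun _ => t).1, (hmulti fun _ => t).2.trans (hprod fun _ => t)⟩
  · rw [huni, EhrhartZonotope.tutte_one_right e (mul_ne_zero hq.ne' ht)]
    exact (hmulti fun _ => t).2.trans ((hprod fun _ => t).trans (by simp only [hpq]))
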